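/- For $k\ge1$, a $(\frac12,\frac12;k)$-comb is a tile consisting of $k$ teeth of width $\frac12$ in a line, consecutive teeth being separated by gaps of width $\frac12$. A board of length $n$ consists of $n$ unit cells in a row. A metatile of length $l\ge1$ is a set of non-overlapping tiles that exactly covers $l$ consecutive unit cells and that cannot be split, at a cell boundary strictly inside it, into two smaller sets of tiles each exactly covering the cells on its side of the boundary. It is mixed if it contains more than one type of tile. Let $\mu_l^{(m_1,m_2)}$ be the number of mixed metatiles of length $l$ (up to translation by whole cells) when tiling with $(\frac12,\frac12;m_1)$- and $(\frac12,\frac12;m_2)$-combs. For a set $W$ of integers, let $P_n^W$ be the number of permutations $\pi$ of $\{1,\dots,n\}$ such that $\pi(i)-i\in W$ for all $i$ (so $P_0^W=1$). Then, for all integers $m\ge0$ and $l\ge2m+3$, $$\mu_l^{(m+1,m+2)}=2\,P_{l-2m-3}^{\{-2,\,m-1,\,m\}}.$$ -/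

import Mathlib

/-- A placed comb: number of teeth `teeth`, and left end `pos` of its leftmost tooth. -/
structure PlacedComb where
  teeth : ℕ
  pos : ℝ

/-- The part of the line covered by a `(w, g; k)`-comb: `k` teeth of width `w`, consecutive teeth
being separated by a gap of width `g`. Teeth are half-open, so that tiles which only share an
end point are disjoint. -/
def PlacedComb.region (w g : ℝ) (t : PlacedComb) : Set ℝ :=
  ⋃ i ∈ Finset.range t.teeth, Set.Ico (t.pos + i * (w + g)) (t.pos + i * (w + g) + w)

/-- `T` is a tiling of the region `R` by `(w, g; k)`-combs with `k ∈ K`: finitely many combs of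
the allowed types, placed without overlap, and together covering exactly `R`. -/
structure IsCombTiling (w g : ℝ) (K : Set ℕ) (T : Set PlacedComb) (R : Set ℝ) : Prop where
  finite : T.Finite
  teeth_mem : ∀ t ∈ T, t.teeth ∈ K
  disjoint : T.PairwiseDisjoint (PlacedComb.region w g)
  cover : ⋃ t ∈ T, t.region w g = R

/-- `T` is a metatile of length `l` (placed with its left end at `0`; the cells are the intervals
`[j, j + 1)`): it covers exactly `l ≥ 1` cells, and it cannot be cut at a cell boundary strictly
inside it into two groups of tiles, each covering exactly the cells on its side. -/
structure IsCombMetatile (w g : ℝ) (K : Set ℕ) (l : ℕ) (T : Set PlacedComb) : Prop where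
  pos : 0 < l
  tiling : IsCombTiling w g K T (Set.Ico 0 (l : ℝ))
  not_split : ¬ ∃ (k : ℕ) (A B : Set PlacedComb), 0 < k ∧ k < l ∧ T = A ∪ B ∧
    IsCombTiling w g K A (Set.Ico 0 (k : ℝ)) ∧ IsCombTiling w g K B (Set.Ico (k : ℝ) (l : ℝ))

/-- A set of tiles is mixed if it contains more than one type of tile. -/
def IsMixed (T : Set PlacedComb) : Prop :=
  ∃ s ∈ T, ∃ t ∈ T, s.teeth ≠ t.teeth

/-- The number of mixed metatiles of length `l` when tiling with `(1/2, 1/2; m₁)`- and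
`(1/2, 1/2; m₂)`-combs. -/
noncomputable def numMixedMetatiles (m₁ m₂ l : ℕ) : ℕ∞ :=
  {T : Set PlacedComb | IsCombMetatile (1 / 2) (1 / 2) {m₁, m₂} l T ∧ IsMixed T}.encard

/-- The number of permutations `π` of an `n`-element chain such that `π i - i ∈ W` for all `i`
(the differences are the same for `{1, …, n}` and `{0, …, n - 1}`). -/
noncomputable def numRestrictedPerms (n : ℕ) (W : Set ℤ) : ℕ :=
  Nat.card {π : Equiv.Perm (Fin n) // ∀ i : Fin n, ((π i : ℕ) : ℤ) - ((i : ℕ) : ℤ) ∈ W}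

/-! A comb starting at a cell boundary fills left halves of consecutive cells; one starting mid-cell
fills right halves. A tiling of `l` cells is thus a pair of compositions of `l` into parts `m + 1`
and `m + 2`, and it is a metatile iff the two share no partial sum strictly between `0` and `l`. As
`l > m + 2`, the two first parts must differ: every metatile is mixed, and the order of the first
parts gives the factor 2.

Send a boundary to the end of the tile starting there, or to itself if neither composition passes
through it. Having no common partial sum makes this map injective. The first tiles end at `m + 1`
and `m + 2`; the last ones start at `l - m - 2` and `l - m - 1`. So the `l - 2m - 3` boundaries from
`m + 1` on are mapped bijectively onto those from `m + 3` on, by steps `0`, `m + 1`, `m + 2`.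
Lowering the values by 2 gives the permutations.

Formally, both counts obey one recursion on the pair of current end points `(a, b)`:
`encard_unsplitTilings_left` and `encard_unsplitTilings_right` against `jumpSequences_zero_succ` and
`jumpSequences_succ_succ`. They are matched in `encard_unsplitTilings_eq_encard_jumpSequences`. -/

/-! ### Jump sequences and their recursion -/

/-- Sequences of target positions for `k` consecutive cells, each cell `i` being sent to `i`,
`i + m + 1` or `i + m + 2`, which together with `a` and `b` cover all positions below `k + 2`. -/
def jumpSequences (m k a b : ℕ) : Set (Fin k → ℕ) :=
  {f | (∀ i : Fin k, f i = i ∨ f i = i + (m + 1) ∨ f i = i + (m + 2)) ∧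
    ∀ y < k + 2, y = a ∨ y = b ∨ ∃ i, f i = y}

theorem jumpSequences_comm (m k a b : ℕ) : jumpSequences m k a b = jumpSequences m k b a := by
  ext f
  simp only [jumpSequences, Set.mem_ofPred_eq]
  refine and_congr_right fun _ => forall₂_congr fun y _ => ?_
  tauto

/-- Pigeonhole. Since `k` values together with `a` and `b` must cover `k + 2` positions, no position
can be covered twice. -/
theorem not_cover_of_card_lt {k N a : ℕ} (hN : k + 1 < N) (f : Fin k → ℕ) :
    ¬ ∀ y < N, y = a ∨ ∃ i, f i = y := by
  intro h
  have hsub : Finset.range N ⊆ insert a (Finset.univ.image f) := by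
    intro y hy
    simpa using h y (Finset.mem_range.1 hy)
  have h1 := Finset.card_le_card hsub
  have h2 := Finset.card_insert_le a (Finset.univ.image f)
  have h3 : (Finset.univ.image f).card ≤ k := by
    simpa using Finset.card_image_le (s := (Finset.univ : Finset (Fin k))) (f := f)
  simp only [Finset.card_range] at h1
  omega

theorem jumpSequences_self (m k a : ℕ) : jumpSequences m k a a = ∅ := by
  refine Set.eq_empty_iff_forall_notMem.2 fun f hf => ?_
  refine not_cover_of_card_lt (k := k) (N := k + 2) (a := a) (by omega) f fun y hy => ?_
  rcases hf.2 y hy with h | h | h <;> tauto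

theorem jumpSequences_zero (m a b : ℕ) (hab : a < b) :
    (jumpSequences m 0 a b).encard = if a = 0 ∧ b = 1 then 1 else 0 := by
  split_ifs with h
  · obtain ⟨rfl, rfl⟩ := h
    rw [Set.encard_eq_one]
    refine ⟨Fin.elim0, Set.eq_singleton_iff_unique_mem.2 ⟨⟨fun i => i.elim0, fun y hy => ?_⟩,
      fun f _ => Subsingleton.elim _ _⟩⟩
    omega
  · rw [Set.encard_eq_zero]
    refine Set.eq_empty_iff_forall_notMem.2 fun f hf => h ?_
    have h0 := hf.2 0 (by omega)
    have h1 := hf.2 1 (by omega)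
    simp only [IsEmpty.exists_iff, or_false] at h0 h1
    omega

/-- `f` with all values raised by one, preceded by the value `v`. -/
def consShift {k : ℕ} (v : ℕ) (f : Fin k → ℕ) : Fin (k + 1) → ℕ :=
  Fin.cons v fun i => f i + 1

theorem consShift_zero {k : ℕ} (v : ℕ) (f : Fin k → ℕ) : consShift v f 0 = v := rfl

theorem consShift_succ {k : ℕ} (v : ℕ) (f : Fin k → ℕ) (i : Fin k) :
    consShift v f i.succ = f i + 1 := by
  simp [consShift]

theorem consShift_injective {k : ℕ} (v : ℕ) :
    Function.Injective (consShift v : (Fin k → ℕ) → Fin (k + 1) → ℕ) := by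
  intro f g h
  funext i
  have := congrFun h i.succ
  simpa [consShift_succ] using this

theorem consShift_steps {m k v : ℕ} {f : Fin k → ℕ} :
    (∀ i : Fin (k + 1), consShift v f i = i ∨ consShift v f i = i + (m + 1) ∨
        consShift v f i = i + (m + 2)) ↔
      (v = 0 ∨ v = m + 1 ∨ v = m + 2) ∧
        ∀ i : Fin k, f i = i ∨ f i = i + (m + 1) ∨ f i = i + (m + 2) := by
  rw [Fin.forall_fin_succ]
  refine and_congr (by simp [consShift_zero]) (forall_congr' fun i => ?_)
  simp only [consShift_succ, Fin.val_succ]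
  omega

theorem exists_eq_consShift {m k : ℕ} {f : Fin (k + 1) → ℕ}
    (hf : ∀ i : Fin (k + 1), f i = i ∨ f i = i + (m + 1) ∨ f i = i + (m + 2)) :
    ∃ v g, f = consShift v g := by
  refine ⟨f 0, fun i => f i.succ - 1, funext fun i => ?_⟩
  refine Fin.cases rfl (fun i => ?_) i
  have := hf i.succ
  simp only [consShift_succ, Fin.val_succ] at this ⊢
  omega

/-- Position `0` can only be hit by the first entry, which is therefore fixed; dropping it moves the
origin by one. -/
theorem jumpSequences_succ_succ (m k a b : ℕ) :
    (jumpSequences m (k + 1) (a + 1) (b + 1)).encard = (jumpSequences m k a b).encard := by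
  rw [← (consShift_injective (k := k) 0).encard_image (jumpSequences m k a b)]
  congr 1
  ext f
  constructor
  · intro hf
    obtain ⟨v, g, rfl⟩ := exists_eq_consShift hf.1
    have h0 : v = 0 := by
      rcases hf.2 0 (by omega) with h | h | ⟨i, h⟩
      · omega
      · omega
      · revert h
        refine Fin.cases (fun h => h) (fun i h => ?_) i
        rw [consShift_succ] at h
        omega
    subst h0
    refine ⟨g, ⟨(consShift_steps.1 hf.1).2, fun y hy => ?_⟩, rfl⟩
    rcases hf.2 (y + 1) (by omega) with h | h | h
    · omega
    · omega
    · rw [Fin.exists_fin_succ] at h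
      simp only [consShift_zero, consShift_succ] at h
      rcases h with h | ⟨i, h⟩
      · omega
      · exact Or.inr (Or.inr ⟨i, by omega⟩)
  · rintro ⟨g, hg, rfl⟩
    refine ⟨consShift_steps.2 ⟨Or.inl rfl, hg.1⟩, fun y hy => ?_⟩
    rw [Fin.exists_fin_succ]
    simp only [consShift_zero, consShift_succ]
    rcases y with _ | y
    · simp
    · rcases hg.2 y (by omega) with h | h | ⟨i, h⟩
      · omega
      · omega
      · exact Or.inr (Or.inr (Or.inr ⟨i, by omega⟩))

/-- The first entry cannot be `0`, which would be covered twice. Its value `m + 1` or `m + 2`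
replaces the used-up end point `0`, and becomes `m` or `m + 1` once the origin moves by one. -/
theorem consShift_mem_jumpSequences_zero {m k v b : ℕ} {g : Fin k → ℕ} :
    consShift v g ∈ jumpSequences m (k + 1) 0 (b + 1) ↔
      (v = m + 1 ∧ g ∈ jumpSequences m k m b) ∨
        (v = m + 2 ∧ g ∈ jumpSequences m k (m + 1) b) := by
  have key : ∀ w, (∀ y < k + 1 + 2, y = 0 ∨ y = b + 1 ∨ ∃ i, consShift (w + 1) g i = y) ↔
      ∀ y < k + 2, y = w ∨ y = b ∨ ∃ i, g i = y := by
    intro w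
    simp only [Fin.exists_fin_succ, consShift_zero, consShift_succ]
    constructor
    · intro h y hy
      have := h (y + 1) (by omega)
      simp only [Nat.add_right_cancel_iff] at this
      rcases this with h | h | h | h
      · omega
      · tauto
      · exact Or.inl h.symm
      · tauto
    · intro h y hy
      rcases y with _ | y
      · simp
      · simp only [Nat.add_right_cancel_iff]
        rcases h y (by omega) with h | h | h
        · exact Or.inr (Or.inr (Or.inl h.symm))
        · tauto
        · tauto
  constructor
  · rintro ⟨h1, h2⟩
    obtain ⟨rfl | rfl | rfl, h3⟩ := consShift_steps.1 h1
    · refine absurd (fun y hy => ?_) (not_cover_of_card_lt (N := k + 2) (a := b) (by omega) g)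
      have := h2 (y + 1) (by omega)
      rw [Fin.exists_fin_succ] at this
      simp only [consShift_zero, consShift_succ, Nat.add_right_cancel_iff] at this
      rcases this with h | h | h | h
      · omega
      · tauto
      · omega
      · tauto
    · exact Or.inl ⟨rfl, h3, (key m).1 h2⟩
    · exact Or.inr ⟨rfl, h3, (key (m + 1)).1 h2⟩
  · rintro (⟨rfl, h1, h2⟩ | ⟨rfl, h1, h2⟩)
    · exact ⟨consShift_steps.2 ⟨by tauto, h1⟩, (key m).2 h2⟩
    · exact ⟨consShift_steps.2 ⟨by tauto, h1⟩, (key (m + 1)).2 h2⟩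

theorem jumpSequences_zero_succ (m k b : ℕ) :
    (jumpSequences m (k + 1) 0 (b + 1)).encard =
      (jumpSequences m k m b).encard + (jumpSequences m k (m + 1) b).encard := by
  rw [← (consShift_injective (k := k) (m + 1)).encard_image (jumpSequences m k m b),
    ← (consShift_injective (k := k) (m + 2)).encard_image (jumpSequences m k (m + 1) b),
    ← Set.encard_union_eq]
  · congr 1
    ext f
    constructor
    · intro hf
      obtain ⟨v, g, rfl⟩ := exists_eq_consShift hf.1
      rcases consShift_mem_jumpSequences_zero.1 hf with ⟨rfl, h⟩ | ⟨rfl, h⟩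
      · exact Or.inl ⟨g, h, rfl⟩
      · exact Or.inr ⟨g, h, rfl⟩
    · rintro (⟨g, h, rfl⟩ | ⟨g, h, rfl⟩)
      · exact consShift_mem_jumpSequences_zero.2 (Or.inl ⟨rfl, h⟩)
      · exact consShift_mem_jumpSequences_zero.2 (Or.inr ⟨rfl, h⟩)
  · rw [Set.disjoint_left]
    rintro _ ⟨g, _, rfl⟩ ⟨g', _, h⟩
    have := congrFun h 0
    simp only [consShift_zero] at this
    omega

/-! ### Restricted permutations as jump sequences -/

theorem numRestrictedPerms_eq_encard_jumpSequences (m n : ℕ) :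
    (numRestrictedPerms n {-2, (m : ℤ) - 1, (m : ℤ)} : ℕ∞) =
      (jumpSequences m n 0 1).encard := by
  have hfin : (numRestrictedPerms n {-2, (m : ℤ) - 1, (m : ℤ)} : ℕ∞) =
      {π : Equiv.Perm (Fin n) | ∀ i : Fin n, ((π i : ℕ) : ℤ) - ((i : ℕ) : ℤ) ∈
        ({-2, (m : ℤ) - 1, (m : ℤ)} : Set ℤ)}.encard := by
    rw [← Set.Finite.cast_ncard_eq (Set.toFinite _)]
    rfl
  have hinj : Function.Injective (fun (π : Equiv.Perm (Fin n)) (i : Fin n) => (π i : ℕ) + 2) := by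
    intro π ρ h
    ext i
    simpa using congrFun h i
  rw [hfin, ← hinj.encard_image]
  congr 1
  ext f
  constructor
  · rintro ⟨π, hπ, rfl⟩
    refine ⟨fun i => ?_, fun y hy => ?_⟩
    · have := hπ i
      simp only [Set.mem_insert_iff, Set.mem_singleton_iff] at this
      dsimp only
      omega
    · by_cases h : y < 2
      · omega
      · refine Or.inr (Or.inr ⟨π.symm ⟨y - 2, by omega⟩, ?_⟩)
        simp only [Equiv.apply_symm_apply]
        omega
  · rintro ⟨h1, h2⟩
    -- Choosing preimages of the values from 2 on gives an injective, hence bijective, self-map of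
    -- `Fin n`; its inverse is the permutation.
    have h3 : ∀ y : Fin n, ∃ i, f i = y + 2 := by
      intro y
      rcases h2 (y + 2) (by omega) with h | h | h
      · omega
      · omega
      · exact h
    choose e he using h3
    have hinj : Function.Injective e := by
      intro y z h
      have h4 := he y
      rw [h, he z] at h4
      exact Fin.ext (by omega)
    let E := Equiv.ofBijective e (Finite.injective_iff_bijective.1 hinj)
    have hE : ∀ i, f i = E.symm i + 2 := by
      intro i
      have h4 := he (E.symm i)
      rwa [show e (E.symm i) = i from E.apply_symm_apply i] at h4
    refine ⟨E.symm, fun i => ?_, funext fun i => (hE i).symm⟩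
    have h4 := h1 i
    rw [hE i] at h4
    simp only [Set.mem_insert_iff, Set.mem_singleton_iff]
    omega

/-! ### Combs as unions of half-cells, indexed by `⌊2 * y⌋` -/

theorem floor_two_mul_eq_iff (y : ℝ) (s : ℤ) :
    ⌊2 * y⌋ = s ↔ (s : ℝ) / 2 ≤ y ∧ y < (s : ℝ) / 2 + 1 / 2 := by
  rw [Int.floor_eq_iff]
  constructor <;> rintro ⟨h1, h2⟩ <;> constructor <;> linarith

theorem mem_region_half_iff (n : ℕ) (p y : ℝ) :
    y ∈ PlacedComb.region (1 / 2) (1 / 2) ⟨n, p⟩ ↔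
      ∃ j : ℕ, j < n ∧ p + j ≤ y ∧ y < p + j + 1 / 2 := by
  simp only [PlacedComb.region, Set.mem_iUnion, Finset.mem_range, Set.mem_Ico, exists_prop]
  norm_num

theorem mem_region_natCast_iff (n a : ℕ) (y : ℝ) :
    y ∈ PlacedComb.region (1 / 2) (1 / 2) ⟨n, (a : ℝ)⟩ ↔
      ∃ j : ℕ, j < n ∧ ⌊2 * y⌋ = 2 * ((a : ℤ) + j) := by
  rw [mem_region_half_iff]
  refine exists_congr fun j => and_congr_right fun _ => ?_
  rw [floor_two_mul_eq_iff]
  push_cast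
  constructor <;> rintro ⟨h1, h2⟩ <;> constructor <;> linarith

theorem mem_region_natCast_add_half_iff (n a : ℕ) (y : ℝ) :
    y ∈ PlacedComb.region (1 / 2) (1 / 2) ⟨n, (a : ℝ) + 1 / 2⟩ ↔
      ∃ j : ℕ, j < n ∧ ⌊2 * y⌋ = 2 * ((a : ℤ) + j) + 1 := by
  rw [mem_region_half_iff]
  refine exists_congr fun j => and_congr_right fun _ => ?_
  rw [floor_two_mul_eq_iff]
  push_cast
  constructor <;> rintro ⟨h1, h2⟩ <;> constructor <;> linarith

theorem floor_two_mul_natCast (a : ℕ) : ⌊2 * (a : ℝ)⌋ = 2 * (a : ℤ) := by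
  rw [floor_two_mul_eq_iff]
  push_cast
  constructor <;> linarith

theorem floor_two_mul_natCast_add_half (a : ℕ) : ⌊2 * ((a : ℝ) + 1 / 2)⌋ = 2 * (a : ℤ) + 1 := by
  rw [floor_two_mul_eq_iff]
  push_cast
  constructor <;> linarith

theorem pos_mem_region {t : PlacedComb} (ht : 0 < t.teeth) :
    t.pos ∈ t.region (1 / 2) (1 / 2) := by
  rw [mem_region_half_iff t.teeth t.pos]
  exact ⟨0, ht, by simp, by simp⟩

theorem pos_le_of_mem_region {t : PlacedComb} {y : ℝ} (hy : y ∈ t.region (1 / 2) (1 / 2)) :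
    t.pos ≤ y := by
  rw [mem_region_half_iff t.teeth t.pos] at hy
  obtain ⟨j, _, h, _⟩ := hy
  have : (0 : ℝ) ≤ j := by positivity
  linarith

/-! ### Removing and adding a tile -/

theorem IsCombTiling.region_subset {w g : ℝ} {K : Set ℕ} {T : Set PlacedComb} {R : Set ℝ}
    (h : IsCombTiling w g K T R) {t : PlacedComb} (ht : t ∈ T) : t.region w g ⊆ R := by
  rw [← h.cover]
  exact Set.subset_biUnion_of_mem (u := PlacedComb.region w g) ht

theorem IsCombTiling.exists_mem {w g : ℝ} {K : Set ℕ} {T : Set PlacedComb} {R : Set ℝ}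
    (h : IsCombTiling w g K T R) {y : ℝ} (hy : y ∈ R) : ∃ t ∈ T, y ∈ t.region w g := by
  rw [← h.cover] at hy
  simpa using hy

theorem IsCombTiling.eq_of_mem {w g : ℝ} {K : Set ℕ} {T : Set PlacedComb} {R : Set ℝ}
    (h : IsCombTiling w g K T R) {s t : PlacedComb} (hs : s ∈ T) (ht : t ∈ T) {y : ℝ}
    (hys : y ∈ s.region w g) (hyt : y ∈ t.region w g) : s = t := by
  by_contra hne
  exact Set.disjoint_left.1 (h.disjoint hs ht hne) hys hyt

theorem IsCombTiling.diff_singleton {w g : ℝ} {K : Set ℕ} {T : Set PlacedComb} {R : Set ℝ}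
    (h : IsCombTiling w g K T R) {t : PlacedComb} (ht : t ∈ T) :
    IsCombTiling w g K (T \ {t}) (R \ t.region w g) where
  finite := h.finite.subset Set.sdiff_subset
  teeth_mem s hs := h.teeth_mem s hs.1
  disjoint := h.disjoint.subset Set.sdiff_subset
  cover := by
    ext y
    simp only [Set.mem_iUnion, exists_prop, Set.mem_sdiff, Set.mem_singleton_iff]
    constructor
    · rintro ⟨s, ⟨hs, hst⟩, hy⟩
      exact ⟨h.region_subset hs hy, fun hyt => hst (h.eq_of_mem hs ht hy hyt)⟩
    · rintro ⟨hyR, hyt⟩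
      obtain ⟨s, hs, hy⟩ := h.exists_mem hyR
      exact ⟨s, ⟨hs, fun e => hyt (e ▸ hy)⟩, hy⟩

theorem IsCombTiling.insert {w g : ℝ} {K : Set ℕ} {T : Set PlacedComb} {R : Set ℝ}
    (h : IsCombTiling w g K T R) {t : PlacedComb} (ht : t.teeth ∈ K)
    (hd : Disjoint (t.region w g) R) :
    IsCombTiling w g K (insert t T) (t.region w g ∪ R) where
  finite := h.finite.insert t
  teeth_mem s hs := by
    rcases hs with rfl | hs
    · exact ht
    · exact h.teeth_mem s hs
  disjoint := h.disjoint.insert fun _ hs _ => hd.mono_right (h.region_subset hs)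
  cover := by rw [Set.biUnion_insert, h.cover]

/-- The tile covering the leftmost point of the region starts inside the region, hence at that
point. This forces all tiles onto the half-integer grid. -/
theorem IsCombTiling.exists_mem_pos_eq {K : Set ℕ} {T : Set PlacedComb} {R : Set ℝ}
    (h : IsCombTiling (1 / 2) (1 / 2) K T R) (hK : ∀ k ∈ K, 0 < k) {p : ℝ} (hp : p ∈ R)
    (hmin : ∀ y ∈ R, p ≤ y) : ∃ k ∈ K, (⟨k, p⟩ : PlacedComb) ∈ T := by
  obtain ⟨t, ht, hpt⟩ := h.exists_mem hp
  have h1 := hmin _ (h.region_subset ht (pos_mem_region (hK _ (h.teeth_mem t ht))))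
  have h2 := pos_le_of_mem_region hpt
  refine ⟨t.teeth, h.teeth_mem t ht, ?_⟩
  rw [le_antisymm h1 h2]
  exact ht

/-! ### The region left over by a partial tiling -/

/-- The left halves of the cells `a, …, l - 1` and the right halves of the cells
`b, …, l - 1`. -/
def cellHalves (l a b : ℕ) : Set ℝ :=
  {y | ∃ j : ℕ, j < l ∧ (a ≤ j ∧ ⌊2 * y⌋ = 2 * (j : ℤ) ∨ b ≤ j ∧ ⌊2 * y⌋ = 2 * (j : ℤ) + 1)}

theorem mem_cellHalves {l a b : ℕ} {y : ℝ} : y ∈ cellHalves l a b ↔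
    ∃ j : ℕ, j < l ∧ (a ≤ j ∧ ⌊2 * y⌋ = 2 * (j : ℤ) ∨ b ≤ j ∧ ⌊2 * y⌋ = 2 * (j : ℤ) + 1) :=
  Iff.rfl

theorem cellHalves_self (l a : ℕ) : cellHalves l a a = Set.Ico (a : ℝ) (l : ℝ) := by
  ext y
  rw [mem_cellHalves, Set.mem_Ico]
  have h1 : (a : ℝ) ≤ y ↔ 2 * (a : ℤ) ≤ ⌊2 * y⌋ := by
    rw [Int.le_floor]
    push_cast
    constructor <;> intro h <;> linarith
  have h2 : y < l ↔ ⌊2 * y⌋ < 2 * (l : ℤ) := by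
    rw [Int.floor_lt]
    push_cast
    constructor <;> intro h <;> linarith
  rw [h1, h2]
  constructor
  · rintro ⟨j, h⟩
    omega
  · rintro ⟨h3, h4⟩
    exact ⟨(⌊2 * y⌋ / 2).toNat, by omega⟩

theorem natCast_mem_cellHalves {l a b x : ℕ} : (x : ℝ) ∈ cellHalves l a b ↔ a ≤ x ∧ x < l := by
  rw [mem_cellHalves, floor_two_mul_natCast]
  constructor
  · rintro ⟨j, h⟩
    omega
  · intro h
    exact ⟨x, by omega⟩

theorem natCast_add_half_mem_cellHalves {l a b x : ℕ} :
    (x : ℝ) + 1 / 2 ∈ cellHalves l a b ↔ b ≤ x ∧ x < l := by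
  rw [mem_cellHalves, floor_two_mul_natCast_add_half]
  constructor
  · rintro ⟨j, h⟩
    omega
  · intro h
    exact ⟨x, by omega⟩

theorem natCast_le_of_mem_cellHalves {l a b : ℕ} (hab : a ≤ b) {y : ℝ}
    (hy : y ∈ cellHalves l a b) : (a : ℝ) ≤ y := by
  obtain ⟨j, h⟩ := mem_cellHalves.1 hy
  have h1 : 2 * (a : ℤ) ≤ ⌊2 * y⌋ := by omega
  rw [Int.le_floor] at h1
  push_cast at h1
  linarith

theorem natCast_add_half_le_of_mem_cellHalves {l a b : ℕ} (hab : b < a) {y : ℝ}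
    (hy : y ∈ cellHalves l a b) : (b : ℝ) + 1 / 2 ≤ y := by
  obtain ⟨j, h⟩ := mem_cellHalves.1 hy
  have h1 : 2 * (b : ℤ) + 1 ≤ ⌊2 * y⌋ := by omega
  rw [Int.le_floor] at h1
  push_cast at h1
  linarith

theorem disjoint_region_cellHalves_left (l a b k : ℕ) :
    Disjoint (PlacedComb.region (1 / 2) (1 / 2) ⟨k, (a : ℝ)⟩) (cellHalves l (a + k) b) := by
  rw [Set.disjoint_left]
  intro y h1 h2
  rw [mem_region_natCast_iff] at h1
  obtain ⟨i, h1⟩ := h1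
  obtain ⟨j, h2⟩ := mem_cellHalves.1 h2
  omega

theorem region_union_cellHalves_left {l a b k : ℕ} (h : a + k ≤ l) :
    PlacedComb.region (1 / 2) (1 / 2) ⟨k, (a : ℝ)⟩ ∪ cellHalves l (a + k) b =
      cellHalves l a b := by
  ext y
  rw [Set.mem_union, mem_region_natCast_iff, mem_cellHalves, mem_cellHalves]
  constructor
  · rintro (⟨j, h⟩ | ⟨j, h⟩)
    · exact ⟨a + j, by push_cast; omega⟩
    · exact ⟨j, by omega⟩
  · rintro ⟨j, h⟩
    by_cases h1 : ⌊2 * y⌋ = 2 * (j : ℤ) ∧ j < a + k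
    · exact Or.inl ⟨j - a, by omega⟩
    · exact Or.inr ⟨j, by omega⟩

theorem disjoint_region_cellHalves_right (l a b k : ℕ) :
    Disjoint (PlacedComb.region (1 / 2) (1 / 2) ⟨k, (b : ℝ) + 1 / 2⟩)
      (cellHalves l a (b + k)) := by
  rw [Set.disjoint_left]
  intro y h1 h2
  rw [mem_region_natCast_add_half_iff] at h1
  obtain ⟨i, h1⟩ := h1
  obtain ⟨j, h2⟩ := mem_cellHalves.1 h2
  omega

theorem region_union_cellHalves_right {l a b k : ℕ} (h : b + k ≤ l) :
    PlacedComb.region (1 / 2) (1 / 2) ⟨k, (b : ℝ) + 1 / 2⟩ ∪ cellHalves l a (b + k) =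
      cellHalves l a b := by
  ext y
  rw [Set.mem_union, mem_region_natCast_add_half_iff, mem_cellHalves, mem_cellHalves]
  constructor
  · rintro (⟨j, h⟩ | ⟨j, h⟩)
    · exact ⟨b + j, by push_cast; omega⟩
    · exact ⟨j, by omega⟩
  · rintro ⟨j, h⟩
    by_cases h1 : ⌊2 * y⌋ = 2 * (j : ℤ) + 1 ∧ j < b + k
    · exact Or.inl ⟨j - b, by omega⟩
    · exact Or.inr ⟨j, by omega⟩

theorem IsCombTiling.add_le_left {K : Set ℕ} {T : Set PlacedComb} {l a b k : ℕ}
    (h : IsCombTiling (1 / 2) (1 / 2) K T (cellHalves l a b)) (hk : 0 < k)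
    (ht : (⟨k, (a : ℝ)⟩ : PlacedComb) ∈ T) : a + k ≤ l := by
  have h1 : (((a + k - 1 : ℕ) : ℕ) : ℝ) ∈ cellHalves l a b := by
    refine h.region_subset ht ?_
    rw [mem_region_natCast_iff, floor_two_mul_natCast]
    exact ⟨k - 1, by omega⟩
  rw [natCast_mem_cellHalves] at h1
  omega

theorem IsCombTiling.add_le_right {K : Set ℕ} {T : Set PlacedComb} {l a b k : ℕ}
    (h : IsCombTiling (1 / 2) (1 / 2) K T (cellHalves l a b)) (hk : 0 < k)
    (ht : (⟨k, (b : ℝ) + 1 / 2⟩ : PlacedComb) ∈ T) : b + k ≤ l := by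
  have h1 : (((b + k - 1 : ℕ) : ℕ) : ℝ) + 1 / 2 ∈ cellHalves l a b := by
    refine h.region_subset ht ?_
    rw [mem_region_natCast_add_half_iff, floor_two_mul_natCast_add_half]
    exact ⟨k - 1, by omega⟩
  rw [natCast_add_half_mem_cellHalves] at h1
  omega

/-! ### Unsplit tilings and their recursion -/

/-- A tile starts at the cell boundary `x`, and a tile starts in the middle of the cell
to the right of `x`. -/
def StartsCell (T : Set PlacedComb) (x : ℕ) : Prop :=
  (∃ k, (⟨k, (x : ℝ)⟩ : PlacedComb) ∈ T) ∧ ∃ k, (⟨k, (x : ℝ) + 1 / 2⟩ : PlacedComb) ∈ T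

/-- The tilings by combs with teeth numbers in `K` of the left halves of the cells `a, …, l - 1`
and the right halves of the cells `b, …, l - 1`, in which tiles do not start in both halves of
any cell, except possibly the initial one. -/
def unsplitTilings (K : Set ℕ) (l a b : ℕ) : Set (Set PlacedComb) :=
  {T | a ≤ l ∧ b ≤ l ∧ IsCombTiling (1 / 2) (1 / 2) K T (cellHalves l a b) ∧
    ∀ x : ℕ, 0 < x → ¬ StartsCell T x}

theorem encard_sep_mem_eq {A B : Set (Set PlacedComb)} {t : PlacedComb}
    (h1 : ∀ T ∈ A, t ∈ T → T \ {t} ∈ B) (h2 : ∀ T ∈ B, t ∉ T ∧ insert t T ∈ A) :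
    {T ∈ A | t ∈ T}.encard = B.encard := by
  have hinj : Set.InjOn (insert t) B := by
    intro T hT T' hT' h
    rw [← Set.insert_sdiff_self_of_notMem (h2 T hT).1, h,
      Set.insert_sdiff_self_of_notMem (h2 T' hT').1]
  rw [← hinj.encard_image]
  congr 1
  ext T
  constructor
  · rintro ⟨hT, ht⟩
    exact ⟨T \ {t}, h1 T hT ht, Set.insert_sdiff_singleton.trans (Set.insert_eq_of_mem ht)⟩
  · rintro ⟨T', hT', rfl⟩
    exact ⟨(h2 T' hT').2, Set.mem_insert _ _⟩

theorem encard_eq_add_of_mem_or {A : Set (Set PlacedComb)} {s t : PlacedComb}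
    (h1 : ∀ T ∈ A, s ∈ T ∨ t ∈ T) (h2 : ∀ T ∈ A, s ∈ T → t ∉ T) :
    A.encard = {T ∈ A | s ∈ T}.encard + {T ∈ A | t ∈ T}.encard := by
  rw [← Set.encard_union_eq]
  · congr 1
    ext T
    constructor
    · intro hT
      exact (h1 T hT).imp (fun h => ⟨hT, h⟩) (fun h => ⟨hT, h⟩)
    · rintro (h | h) <;> exact h.1
  · exact Set.disjoint_left.2 fun T hs ht => h2 T hs.1 hs.2 ht.2

theorem notMem_of_teeth_ne {K : Set ℕ} (hK : ∀ k ∈ K, 0 < k) {T : Set PlacedComb} {R : Set ℝ}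
    (h : IsCombTiling (1 / 2) (1 / 2) K T R) {j k : ℕ} (hjk : j ≠ k) {p : ℝ}
    (hj : (⟨j, p⟩ : PlacedComb) ∈ T) : (⟨k, p⟩ : PlacedComb) ∉ T := by
  intro hk
  have := h.eq_of_mem hj hk (pos_mem_region (hK _ (h.teeth_mem _ hj)))
    (pos_mem_region (hK _ (h.teeth_mem _ hk)))
  exact hjk (congrArg PlacedComb.teeth this)

theorem StartsCell.mono {S T : Set PlacedComb} (h : S ⊆ T) {x : ℕ} (hx : StartsCell S x) :
    StartsCell T x :=
  hx.imp (fun ⟨k, hk⟩ => ⟨k, h hk⟩) (fun ⟨k, hk⟩ => ⟨k, h hk⟩)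

theorem natCast_ne_natCast_add_half (x y : ℕ) : (x : ℝ) ≠ (y : ℝ) + 1 / 2 := by
  intro h
  have h1 := floor_two_mul_natCast x
  rw [h, floor_two_mul_natCast_add_half] at h1
  omega

/-- Adding the tile back must not make tiles start in both halves of cell `a`. If `a < b`, the right
half of that cell lies outside the region; if `a = 0`, the cell is exempt. -/
theorem encard_sep_left {K : Set ℕ} (hK : ∀ k ∈ K, 0 < k) {l a b k : ℕ} (hk : k ∈ K)
    (hal : a < l) (h0 : a < b ∨ a = 0) :
    {T ∈ unsplitTilings K l a b | (⟨k, (a : ℝ)⟩ : PlacedComb) ∈ T}.encard =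
      (unsplitTilings K l (a + k) b).encard := by
  refine encard_sep_mem_eq ?_ ?_
  · rintro T ⟨_, hb, hT, hx⟩ ht
    have hle := hT.add_le_left (hK k hk) ht
    refine ⟨hle, hb, ?_, fun x h h' => hx x h (h'.mono Set.sdiff_subset)⟩
    have h1 := hT.diff_singleton ht
    rwa [← region_union_cellHalves_left hle, Set.union_sdiff_cancel_left
      (Set.disjoint_iff.1 (disjoint_region_cellHalves_left l a b k))] at h1
  · rintro T ⟨ha, hb, hT, hx⟩
    refine ⟨fun ht => ?_, hal.le, hb, ?_, ?_⟩
    · have := hT.region_subset ht (pos_mem_region (hK k hk))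
      rw [natCast_mem_cellHalves] at this
      have := hK k hk
      omega
    · have := hT.insert (t := ⟨k, (a : ℝ)⟩) hk (disjoint_region_cellHalves_left l a b k)
      rwa [region_union_cellHalves_left ha] at this
    · rintro x hx0 ⟨⟨i, hi⟩, ⟨j, hj⟩⟩
      rcases hj with hj | hj
      · exact natCast_ne_natCast_add_half a x (congrArg PlacedComb.pos hj).symm
      · rcases hi with hi | hi
        · have hxa : x = a := Nat.cast_injective (R := ℝ) (congrArg PlacedComb.pos hi)
          subst hxa
          have := hT.region_subset hj (pos_mem_region (hK _ (hT.teeth_mem _ hj)))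
          rw [natCast_add_half_mem_cellHalves] at this
          omega
        · exact hx x hx0 ⟨⟨i, hi⟩, ⟨j, hj⟩⟩

theorem encard_sep_right {K : Set ℕ} (hK : ∀ k ∈ K, 0 < k) {l a b k : ℕ} (hk : k ∈ K)
    (hbl : b < l) (h0 : b < a) :
    {T ∈ unsplitTilings K l a b | (⟨k, (b : ℝ) + 1 / 2⟩ : PlacedComb) ∈ T}.encard =
      (unsplitTilings K l a (b + k)).encard := by
  refine encard_sep_mem_eq ?_ ?_
  · rintro T ⟨ha, _, hT, hx⟩ ht
    have hle := hT.add_le_right (hK k hk) ht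
    refine ⟨ha, hle, ?_, fun x h h' => hx x h (h'.mono Set.sdiff_subset)⟩
    have h1 := hT.diff_singleton ht
    rwa [← region_union_cellHalves_right hle, Set.union_sdiff_cancel_left
      (Set.disjoint_iff.1 (disjoint_region_cellHalves_right l a b k))] at h1
  · rintro T ⟨ha, hb, hT, hx⟩
    refine ⟨fun ht => ?_, ha, hbl.le, ?_, ?_⟩
    · have := hT.region_subset ht (pos_mem_region (hK k hk))
      rw [natCast_add_half_mem_cellHalves] at this
      have := hK k hk
      omega
    · have := hT.insert (t := ⟨k, (b : ℝ) + 1 / 2⟩) hk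
        (disjoint_region_cellHalves_right l a b k)
      rwa [region_union_cellHalves_right hb] at this
    · rintro x hx0 ⟨⟨i, hi⟩, ⟨j, hj⟩⟩
      rcases hi with hi | hi
      · exact natCast_ne_natCast_add_half x b (congrArg PlacedComb.pos hi)
      · rcases hj with hj | hj
        · have hxb : x = b := by
            have := congrArg PlacedComb.pos hj
            simp only [add_left_inj, Nat.cast_inj] at this
            exact this
          subst hxb
          have := hT.region_subset hi (pos_mem_region (hK _ (hT.teeth_mem _ hi)))
          rw [natCast_mem_cellHalves] at this
          omega
        · exact hx x hx0 ⟨⟨i, hi⟩, ⟨j, hj⟩⟩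

theorem IsCombTiling.exists_left {K : Set ℕ} (hK : ∀ k ∈ K, 0 < k) {T : Set PlacedComb}
    {l a b : ℕ} (h : IsCombTiling (1 / 2) (1 / 2) K T (cellHalves l a b)) (hal : a < l)
    (hab : a ≤ b) : ∃ k ∈ K, (⟨k, (a : ℝ)⟩ : PlacedComb) ∈ T :=
  h.exists_mem_pos_eq hK (natCast_mem_cellHalves.2 ⟨le_rfl, hal⟩)
    fun _ => natCast_le_of_mem_cellHalves hab

theorem IsCombTiling.exists_right {K : Set ℕ} (hK : ∀ k ∈ K, 0 < k) {T : Set PlacedComb}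
    {l a b : ℕ} (h : IsCombTiling (1 / 2) (1 / 2) K T (cellHalves l a b)) (hbl : b < l)
    (hab : b < a) : ∃ k ∈ K, (⟨k, (b : ℝ) + 1 / 2⟩ : PlacedComb) ∈ T :=
  h.exists_mem_pos_eq hK (natCast_add_half_mem_cellHalves.2 ⟨le_rfl, hbl⟩)
    fun _ => natCast_add_half_le_of_mem_cellHalves hab

/-- Once the tile at `a` is removed, `a + 1 / 2` is the leftmost point still to be covered. -/
theorem IsCombTiling.startsCell {K : Set ℕ} (hK : ∀ k ∈ K, 0 < k) {T : Set PlacedComb}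
    {l a : ℕ} (h : IsCombTiling (1 / 2) (1 / 2) K T (cellHalves l a a)) (hal : a < l) :
    StartsCell T a := by
  obtain ⟨k, hk, ht⟩ := h.exists_left hK hal le_rfl
  have hle := h.add_le_left (hK k hk) ht
  have h1 := h.diff_singleton ht
  rw [← region_union_cellHalves_left hle, Set.union_sdiff_cancel_left
    (Set.disjoint_iff.1 (disjoint_region_cellHalves_left l a a k))] at h1
  obtain ⟨j, _, hj⟩ := h1.exists_right hK hal (by have := hK k hk; omega)
  exact ⟨⟨k, ht⟩, ⟨j, hj.1⟩⟩

theorem unsplitTilings_self {K : Set ℕ} (hK : ∀ k ∈ K, 0 < k) {l a : ℕ} (ha : 0 < a)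
    (hal : a < l) : unsplitTilings K l a a = ∅ :=
  Set.eq_empty_iff_forall_notMem.2 fun _ hT => hT.2.2.2 a ha (hT.2.2.1.startsCell hK hal)

/-- Overshooting the board has to be excluded explicitly: `cellHalves l a b` does not distinguish `a
> l` from `a = l`. -/
theorem unsplitTilings_of_lt_left {K : Set ℕ} {l a b : ℕ} (h : l < a) :
    unsplitTilings K l a b = ∅ :=
  Set.eq_empty_iff_forall_notMem.2 fun _ hT => by have := hT.1; omega

theorem unsplitTilings_of_lt_right {K : Set ℕ} {l a b : ℕ} (h : l < b) :
    unsplitTilings K l a b = ∅ :=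
  Set.eq_empty_iff_forall_notMem.2 fun _ hT => by have := hT.2.1; omega

theorem encard_unsplitTilings_end {K : Set ℕ} (hK : ∀ k ∈ K, 0 < k) (l : ℕ) :
    (unsplitTilings K l l l).encard = 1 := by
  rw [Set.encard_eq_one]
  refine ⟨∅, Set.eq_singleton_iff_unique_mem.2 ⟨⟨le_rfl, le_rfl, ?_, ?_⟩, ?_⟩⟩
  · rw [cellHalves_self, Set.Ico_self]
    exact ⟨Set.finite_empty, by simp, by simp, by simp⟩
  · rintro x _ ⟨⟨_, h⟩, _⟩
    exact h
  · rintro T ⟨_, _, hT, _⟩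
    refine Set.eq_empty_iff_forall_notMem.2 fun t ht => ?_
    have := hT.region_subset ht (pos_mem_region (hK _ (hT.teeth_mem t ht)))
    rw [cellHalves_self, Set.Ico_self] at this
    exact this

theorem encard_unsplitTilings_left (m : ℕ) {l a b : ℕ} (hal : a < l) (hab : a ≤ b)
    (h0 : a < b ∨ a = 0) : (unsplitTilings {m + 1, m + 2} l a b).encard =
      (unsplitTilings {m + 1, m + 2} l (a + (m + 1)) b).encard +
        (unsplitTilings {m + 1, m + 2} l (a + (m + 2)) b).encard := by
  have hK : ∀ k ∈ ({m + 1, m + 2} : Set ℕ), 0 < k := by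
    rintro k (rfl | rfl) <;> omega
  rw [← encard_sep_left hK (Or.inl rfl) hal h0, ← encard_sep_left hK (Or.inr rfl) hal h0]
  refine encard_eq_add_of_mem_or (fun T hT => ?_)
    fun T hT => notMem_of_teeth_ne hK hT.2.2.1 (by omega)
  obtain ⟨k, rfl | rfl, h⟩ := hT.2.2.1.exists_left hK hal hab
  · exact Or.inl h
  · exact Or.inr h

theorem encard_unsplitTilings_right (m : ℕ) {l a b : ℕ} (hbl : b < l) (hab : b < a) :
    (unsplitTilings {m + 1, m + 2} l a b).encard =
      (unsplitTilings {m + 1, m + 2} l a (b + (m + 1))).encard +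
        (unsplitTilings {m + 1, m + 2} l a (b + (m + 2))).encard := by
  have hK : ∀ k ∈ ({m + 1, m + 2} : Set ℕ), 0 < k := by
    rintro k (rfl | rfl) <;> omega
  rw [← encard_sep_right hK (Or.inl rfl) hbl hab, ← encard_sep_right hK (Or.inr rfl) hbl hab]
  refine encard_eq_add_of_mem_or (fun T hT => ?_)
    fun T hT => notMem_of_teeth_ne hK hT.2.2.1 (by omega)
  obtain ⟨k, rfl | rfl, h⟩ := hT.2.2.1.exists_right hK hbl hab
  · exact Or.inl h
  · exact Or.inr h

/-! ### Matching the two recursions -/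

/-- The two remaining lengths `m + 2 - a > m + 2 - b` must each be filled by a single tile, so they
are `m + 2` and `m + 1`. -/
theorem encard_unsplitTilings_base_lt {m i a b : ℕ} (hi : 0 < i) (hab : a < b)
    (hb : b ≤ m + 1) : (unsplitTilings {m + 1, m + 2} (i + m + 2) (i + a) (i + b)).encard =
      if a = 0 ∧ b = 1 then 1 else 0 := by
  have hK : ∀ k ∈ ({m + 1, m + 2} : Set ℕ), 0 < k := by
    rintro k (rfl | rfl) <;> omega
  have hright : (unsplitTilings {m + 1, m + 2} (i + m + 2) (i + m + 2) (i + b)).encard =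
      if b = 1 then 1 else 0 := by
    rw [encard_unsplitTilings_right m (by omega) (by omega),
      unsplitTilings_of_lt_right (b := i + b + (m + 2)) (by omega), Set.encard_empty, add_zero]
    split_ifs with h
    · subst h
      rw [show i + 1 + (m + 1) = i + m + 2 by omega, encard_unsplitTilings_end hK]
    · rw [unsplitTilings_of_lt_right (by omega), Set.encard_empty]
  rw [encard_unsplitTilings_left m (by omega) (by omega) (by omega)]
  rcases a with _ | _ | a
  · have hleft : (unsplitTilings {m + 1, m + 2} (i + m + 2) (i + 0 + (m + 1)) (i + b)).encard
        = 0 := by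
      rcases eq_or_lt_of_le hb with rfl | hb
      · rw [show i + 0 + (m + 1) = i + (m + 1) by omega,
          unsplitTilings_self hK (by omega) (by omega), Set.encard_empty]
      · rw [encard_unsplitTilings_right m (by omega) (by omega),
          unsplitTilings_of_lt_right (b := i + b + (m + 2)) (by omega), Set.encard_empty,
          add_zero]
        by_cases h : b = 1
        · subst h
          rw [encard_unsplitTilings_left m (by omega) (by omega) (by omega),
            unsplitTilings_of_lt_left (by omega), unsplitTilings_of_lt_left (by omega),
            Set.encard_empty, add_zero]
        · rw [unsplitTilings_of_lt_right (by omega), Set.encard_empty]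
    rw [hleft, show i + 0 + (m + 2) = i + m + 2 by omega, hright, zero_add]
    simp
  · rw [unsplitTilings_of_lt_left (a := i + (0 + 1) + (m + 2)) (by omega), Set.encard_empty,
      show i + (0 + 1) + (m + 1) = i + m + 2 by omega, hright, if_neg (by omega),
      if_neg (by omega), add_zero]
  · rw [unsplitTilings_of_lt_left (by omega), unsplitTilings_of_lt_left (by omega),
      Set.encard_empty, if_neg (by omega), add_zero]

theorem encard_unsplitTilings_base_gt {m i a b : ℕ} (hi : 0 < i) (hab : b < a)
    (ha : a ≤ m + 1) : (unsplitTilings {m + 1, m + 2} (i + m + 2) (i + a) (i + b)).encard =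
      if b = 0 ∧ a = 1 then 1 else 0 := by
  have hK : ∀ k ∈ ({m + 1, m + 2} : Set ℕ), 0 < k := by
    rintro k (rfl | rfl) <;> omega
  have hleft : (unsplitTilings {m + 1, m + 2} (i + m + 2) (i + a) (i + m + 2)).encard =
      if a = 1 then 1 else 0 := by
    rw [encard_unsplitTilings_left m (by omega) (by omega) (by omega),
      unsplitTilings_of_lt_left (a := i + a + (m + 2)) (by omega), Set.encard_empty, add_zero]
    split_ifs with h
    · subst h
      rw [show i + 1 + (m + 1) = i + m + 2 by omega, encard_unsplitTilings_end hK]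
    · rw [unsplitTilings_of_lt_left (by omega), Set.encard_empty]
  rw [encard_unsplitTilings_right m (by omega) (by omega)]
  rcases b with _ | _ | b
  · have hright : (unsplitTilings {m + 1, m + 2} (i + m + 2) (i + a) (i + 0 + (m + 1))).encard
        = 0 := by
      rcases eq_or_lt_of_le ha with rfl | ha
      · rw [show i + 0 + (m + 1) = i + (m + 1) by omega,
          unsplitTilings_self hK (by omega) (by omega), Set.encard_empty]
      · rw [encard_unsplitTilings_left m (by omega) (by omega) (by omega),
          unsplitTilings_of_lt_left (a := i + a + (m + 2)) (by omega), Set.encard_empty,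
          add_zero]
        by_cases h : a = 1
        · subst h
          rw [encard_unsplitTilings_right m (by omega) (by omega),
            unsplitTilings_of_lt_right (by omega), unsplitTilings_of_lt_right (by omega),
            Set.encard_empty, add_zero]
        · rw [unsplitTilings_of_lt_left (by omega), Set.encard_empty]
    rw [hright, show i + 0 + (m + 2) = i + m + 2 by omega, hleft, zero_add]
    simp
  · rw [unsplitTilings_of_lt_right (b := i + (0 + 1) + (m + 2)) (by omega), Set.encard_empty,
      show i + (0 + 1) + (m + 1) = i + m + 2 by omega, hleft, if_neg (by omega),
      if_neg (by omega), add_zero]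
  · rw [unsplitTilings_of_lt_right (by omega), unsplitTilings_of_lt_right (by omega),
      Set.encard_empty, if_neg (by omega), add_zero]

/-- Induction on `k`, with `i` the boundary under consideration. If an end point is at `i`, a tile
starts there; otherwise only the origin moves to `i + 1`. -/
theorem encard_unsplitTilings_eq_encard_jumpSequences (m k : ℕ) :
    ∀ i a b : ℕ, 0 < i → a ≠ b → a ≤ m + 1 → b ≤ m + 1 →
      (unsplitTilings {m + 1, m + 2} (i + k + m + 2) (i + a) (i + b)).encard =
        (jumpSequences m k a b).encard := by
  have hK : ∀ k ∈ ({m + 1, m + 2} : Set ℕ), 0 < k := by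
    rintro k (rfl | rfl) <;> omega
  induction k with
  | zero =>
    intro i a b hi hab ha hb
    rw [add_zero]
    rcases lt_or_gt_of_ne hab with h | h
    · rw [encard_unsplitTilings_base_lt hi h hb, jumpSequences_zero m a b h]
    · rw [encard_unsplitTilings_base_gt hi h ha, jumpSequences_comm, jumpSequences_zero m b a h]
  | succ k ih =>
    -- Extends the induction hypothesis to `a = b`, where both counts vanish: a common boundary on
    -- one side, a doubly covered position on the other.
    have ih' : ∀ i a b : ℕ, 0 < i → a ≤ m + 1 → b ≤ m + 1 →
        (unsplitTilings {m + 1, m + 2} (i + (k + 1) + m + 2) (i + 1 + a) (i + 1 + b)).encard =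
          (jumpSequences m k a b).encard := by
      intro i a b hi ha hb
      by_cases hab : a = b
      · subst hab
        rw [jumpSequences_self, unsplitTilings_self hK (by omega) (by omega), Set.encard_empty,
          Set.encard_empty]
      · rw [show i + (k + 1) + m + 2 = i + 1 + k + m + 2 by omega]
        exact ih (i + 1) a b (by omega) hab ha hb
    intro i a b hi hab ha hb
    rcases a with _ | a <;> rcases b with _ | b
    · exact absurd rfl hab
    · rw [encard_unsplitTilings_left m (by omega) (by omega) (by omega), jumpSequences_zero_succ,
        ← ih' i m b hi (by omega) (by omega), ← ih' i (m + 1) b hi (by omega) (by omega)]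
      congr 3 <;> omega
    · rw [encard_unsplitTilings_right m (by omega) (by omega), jumpSequences_comm,
        jumpSequences_zero_succ, jumpSequences_comm m k m a, jumpSequences_comm m k (m + 1) a,
        ← ih' i a m hi (by omega) (by omega), ← ih' i a (m + 1) hi (by omega) (by omega)]
      congr 3 <;> omega
    · rw [jumpSequences_succ_succ, ← ih' i a b hi (by omega) (by omega)]
      congr 2 <;> omega

/-! ### Metatiles as unsplit tilings -/

/-- Cell `x` is filled by the first teeth of two tiles starting in it. Teeth of a comb start at
distance 1 from each other, so a comb coming from the left would have to meet this cell in order to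
pass it. -/
theorem StartsCell.region_subset_of_lt {K : Set ℕ} (hK : ∀ k ∈ K, 0 < k) {T : Set PlacedComb}
    {R : Set ℝ} (h : IsCombTiling (1 / 2) (1 / 2) K T R) {x : ℕ} (hx : StartsCell T x)
    {t : PlacedComb} (ht : t ∈ T) (htx : t.pos < x) :
    t.region (1 / 2) (1 / 2) ⊆ Set.Iio (x : ℝ) := by
  obtain ⟨⟨k₀, h₀⟩, ⟨k₁, h₁⟩⟩ := hx
  have hleft : ∀ y : ℝ, (x : ℝ) ≤ y → y < x + 1 / 2 → y ∉ t.region (1 / 2) (1 / 2) := by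
    intro y hy hy' hyt
    have := h.eq_of_mem ht h₀ hyt
      ((mem_region_half_iff _ _ _).2 ⟨0, hK _ (h.teeth_mem _ h₀), by simpa,
        by rw [Nat.cast_zero]; linarith⟩)
    rw [this] at htx
    exact lt_irrefl _ htx
  have hright : ∀ y : ℝ, (x : ℝ) + 1 / 2 ≤ y → y < x + 1 → y ∉ t.region (1 / 2) (1 / 2) := by
    intro y hy hy' hyt
    have := h.eq_of_mem ht h₁ hyt ((mem_region_half_iff _ _ _).2
      ⟨0, hK _ (h.teeth_mem _ h₁), by rw [Nat.cast_zero]; linarith, by rw [Nat.cast_zero]; linarith⟩)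
    rw [this] at htx
    dsimp only at htx
    linarith
  have hcell : ∀ y : ℝ, (x : ℝ) ≤ y → y < x + 1 → y ∉ t.region (1 / 2) (1 / 2) := by
    intro y hy hy'
    rcases lt_or_ge y (x + 1 / 2) with h2 | h2
    · exact hleft y hy h2
    · exact hright y h2 hy'
  have htooth : ∀ j : ℕ, j < t.teeth → t.pos + j < x := by
    intro j
    induction j with
    | zero => intro _; simpa
    | succ j ih =>
      intro hj
      have h2 := ih (by omega)
      by_contra! h3
      refine hcell _ h3 (by push_cast; linarith) ?_
      rw [mem_region_half_iff t.teeth t.pos]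
      exact ⟨j + 1, hj, le_rfl, by linarith⟩
  intro y hy
  have hyt := hy
  rw [mem_region_half_iff t.teeth t.pos] at hy
  obtain ⟨j, hj, h2, h3⟩ := hy
  have h4 := htooth j hj
  by_contra h5
  rw [Set.mem_Iio, not_lt] at h5
  exact hcell y h5 (by linarith) hyt

theorem StartsCell.exists_split {K : Set ℕ} (hK : ∀ k ∈ K, 0 < k) {T : Set PlacedComb}
    {l : ℕ} (h : IsCombTiling (1 / 2) (1 / 2) K T (Set.Ico 0 (l : ℝ))) {x : ℕ}
    (hx : StartsCell T x) :
    ∃ A B : Set PlacedComb, T = A ∪ B ∧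
      IsCombTiling (1 / 2) (1 / 2) K A (Set.Ico 0 (x : ℝ)) ∧
      IsCombTiling (1 / 2) (1 / 2) K B (Set.Ico (x : ℝ) (l : ℝ)) := by
  have hxl : (x : ℝ) < l := by
    obtain ⟨⟨k, hk⟩, _⟩ := hx
    exact (h.region_subset hk (pos_mem_region (hK _ (h.teeth_mem _ hk)))).2
  have hlt : ∀ t ∈ T, t.pos < x → t.region (1 / 2) (1 / 2) ⊆ Set.Iio (x : ℝ) :=
    fun t ht => hx.region_subset_of_lt hK h ht
  have hge : ∀ t : PlacedComb, (x : ℝ) ≤ t.pos → t.region (1 / 2) (1 / 2) ⊆ Set.Ici (x : ℝ) :=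
    fun t htx y hy => htx.trans (pos_le_of_mem_region hy)
  have hA : {t ∈ T | t.pos < x} ⊆ T := fun _ ht => ht.1
  have hB : {t ∈ T | (x : ℝ) ≤ t.pos} ⊆ T := fun _ ht => ht.1
  refine ⟨{t ∈ T | t.pos < x}, {t ∈ T | (x : ℝ) ≤ t.pos}, ?_,
    ⟨h.finite.subset hA, fun t ht => h.teeth_mem t (hA ht), h.disjoint.subset hA, ?_⟩,
    ⟨h.finite.subset hB, fun t ht => h.teeth_mem t (hB ht), h.disjoint.subset hB, ?_⟩⟩
  · ext t
    constructor
    · intro ht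
      exact (lt_or_ge t.pos x).imp (fun h => ⟨ht, h⟩) (fun h => ⟨ht, h⟩)
    · rintro (h | h) <;> exact h.1
  · ext y
    simp only [Set.mem_iUnion, exists_prop]
    constructor
    · rintro ⟨t, ht, hy⟩
      exact ⟨(h.region_subset ht.1 hy).1, hlt t ht.1 ht.2 hy⟩
    · rintro ⟨h0, h1⟩
      obtain ⟨t, ht, hy⟩ := h.exists_mem (y := y) ⟨h0, h1.trans hxl⟩
      exact ⟨t, ⟨ht, (pos_le_of_mem_region hy).trans_lt h1⟩, hy⟩
  · ext y
    simp only [Set.mem_iUnion, exists_prop]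
    constructor
    · rintro ⟨t, ht, hy⟩
      exact ⟨hge t ht.2 hy, (h.region_subset ht.1 hy).2⟩
    · rintro ⟨h0, h1⟩
      obtain ⟨t, ht, hy⟩ := h.exists_mem (y := y) ⟨(Nat.cast_nonneg x).trans h0, h1⟩
      refine ⟨t, ⟨ht, ?_⟩, hy⟩
      by_contra! h2
      exact absurd (hlt t ht h2 hy) (not_lt.2 h0)

theorem isCombMetatile_iff_mem_unsplitTilings {K : Set ℕ} (hK : ∀ k ∈ K, 0 < k) {l : ℕ}
    (hl : 0 < l) (T : Set PlacedComb) :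
    IsCombMetatile (1 / 2) (1 / 2) K l T ↔ T ∈ unsplitTilings K l 0 0 := by
  have h0 : cellHalves l 0 0 = Set.Ico 0 (l : ℝ) := by simpa using cellHalves_self l 0
  constructor
  · intro h
    refine ⟨hl.le, hl.le, h0 ▸ h.tiling, fun x hx hs => ?_⟩
    obtain ⟨A, B, hAB⟩ := hs.exists_split hK h.tiling
    refine h.not_split ⟨x, A, B, hx, ?_, hAB⟩
    obtain ⟨⟨k, hk⟩, _⟩ := hs
    have := (h.tiling.region_subset hk (pos_mem_region (hK _ (h.tiling.teeth_mem _ hk)))).2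
    exact Nat.cast_lt.1 this
  · rintro ⟨_, _, hT, hx⟩
    refine ⟨hl, h0 ▸ hT, ?_⟩
    rintro ⟨k, A, B, hk, hkl, rfl, _, hB⟩
    rw [← cellHalves_self] at hB
    exact hx k hk ((hB.startsCell hK hkl).mono Set.subset_union_right)

/-- If both tiles starting in cell `0` had `k` teeth, removing them would leave the region from `k <
l` on, and tiles would start in both halves of cell `k`. -/
theorem isMixed_of_mem_unsplitTilings {m l : ℕ} (hl : m + 2 < l) {T : Set PlacedComb}
    (hT : T ∈ unsplitTilings {m + 1, m + 2} l 0 0) : IsMixed T := by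
  have hK : ∀ k ∈ ({m + 1, m + 2} : Set ℕ), 0 < k := by
    rintro k (rfl | rfl) <;> omega
  obtain ⟨_, _, h, hx⟩ := hT
  obtain ⟨⟨k, hk⟩, ⟨j, hj⟩⟩ := h.startsCell hK (by omega)
  refine ⟨_, hk, _, hj, fun hkj => ?_⟩
  dsimp only at hkj
  subst hkj
  have hkK := h.teeth_mem _ hk
  have hk0 := hK k hkK
  have h1 := h.diff_singleton hk
  rw [← region_union_cellHalves_left (h.add_le_left hk0 hk), Set.union_sdiff_cancel_left
    (Set.disjoint_iff.1 (disjoint_region_cellHalves_left l 0 0 k))] at h1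
  have hj' : (⟨k, ((0 : ℕ) : ℝ) + 1 / 2⟩ : PlacedComb) ∈ T \ {⟨k, ((0 : ℕ) : ℝ)⟩} :=
    ⟨hj, fun e => natCast_ne_natCast_add_half 0 0 (congrArg PlacedComb.pos e).symm⟩
  have h2 := h1.diff_singleton hj'
  rw [← region_union_cellHalves_right (h1.add_le_right hk0 hj'), Set.union_sdiff_cancel_left
    (Set.disjoint_iff.1 (disjoint_region_cellHalves_right l (0 + k) 0 k))] at h2
  have hkl : 0 + k < l := by
    rcases hkK with hkK | hkK
    · have : k = m + 1 := hkK
      omega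
    · have : k = m + 2 := hkK
      omega
  exact hx (0 + k) (by omega) ((h2.startsCell hK hkl).mono
    (Set.sdiff_subset.trans Set.sdiff_subset))

theorem theorem4 (m l : ℕ) (hl : 2 * m + 3 ≤ l) :
    numMixedMetatiles (m + 1) (m + 2) l =
      ((2 * numRestrictedPerms (l - (2 * m + 3)) {-2, (m : ℤ) - 1, (m : ℤ)} : ℕ) : ℕ∞) := by
  have hK : ∀ k ∈ ({m + 1, m + 2} : Set ℕ), 0 < k := by
    rintro k (rfl | rfl) <;> omega
  have hset : {T : Set PlacedComb | IsCombMetatile (1 / 2) (1 / 2) {m + 1, m + 2} l T ∧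
      IsMixed T} = unsplitTilings {m + 1, m + 2} l 0 0 := by
    ext T
    rw [Set.mem_ofPred_eq, isCombMetatile_iff_mem_unsplitTilings hK (by omega)]
    exact and_iff_left_of_imp (isMixed_of_mem_unsplitTilings (by omega))
  obtain ⟨n, rfl⟩ := Nat.exists_eq_add_of_le' hl
  -- The first tiles lead to the end points `(m + 1, m + 2)` or `(m + 2, m + 1)`, that is, `(0, 1)`
  -- or `(1, 0)` relative to `i = m + 1`.
  have h1 := encard_unsplitTilings_eq_encard_jumpSequences m n (m + 1) 0 1 (by omega) (by omega)
    (by omega) (by omega)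
  have h2 := encard_unsplitTilings_eq_encard_jumpSequences m n (m + 1) 1 0 (by omega) (by omega)
    (by omega) (by omega)
  rw [show m + 1 + n + m + 2 = n + (2 * m + 3) by omega] at h1 h2
  rw [add_zero, show m + 1 + 1 = m + 2 from rfl] at h1 h2
  rw [numMixedMetatiles, hset, encard_unsplitTilings_left m (by omega) le_rfl (Or.inr rfl),
    encard_unsplitTilings_right m (a := 0 + (m + 1)) (by omega) (by omega),
    encard_unsplitTilings_right m (a := 0 + (m + 2)) (by omega) (by omega)]
  simp only [zero_add]
  -- The cases of equal first tiles contribute nothing; the other two are equal by symmetry.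
  rw [unsplitTilings_self hK (a := m + 1) (by omega) (by omega),
    unsplitTilings_self hK (a := m + 2) (by omega) (by omega), Set.encard_empty, zero_add,
    add_zero, h1, h2, jumpSequences_comm m n 1 0, Nat.add_sub_cancel, Nat.cast_mul,
    numRestrictedPerms_eq_encard_jumpSequences, Nat.cast_ofNat, two_mul]
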